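/- \textbf{Setting.} Formulas are built from a denumerable set of variables with the binary connectives $\&,\wedge,\to$ and the constant $\bot$; put $\varphi\vee\psi:=((\varphi\to\psi)\to\psi)\wedge((\psi\to\varphi)\to\varphi)$. Monoidal t-norm based logic MTL has modus ponens as its only rule and the axiom schemata $(\varphi\to\psi)\to((\psi\to\chi)\to(\varphi\to\chi))$; $(\varphi\&\psi)\to\varphi$; $(\varphi\&\psi)\to(\psi\&\varphi)$; $(\varphi\wedge\psi)\to\varphi$; $(\varphi\wedge\psi)\to(\psi\wedge\varphi)$; $(\varphi\&(\varphi\to\psi))\to(\psi\wedge\varphi)$; $(\varphi\to(\psi\to\chi))\to((\varphi\&\psi)\to\chi)$; $((\varphi\&\psi)\to\chi)\to(\varphi\to(\psi\to\chi))$; $((\varphi\to\psi)\to\chi)\to(((\psi\to\varphi)\to\chi)\to\chi)$; $\bot\to\varphi$. An (axiomatic) extension $L$ of MTL is obtained by adding further axiom schemata; $\Gamma\vdash_L\varphi$ denotes derivability from a set $\Gamma$ of formulas. An MTL-algebra is an algebra $\langle A,*,\Rightarrow,\sqcap,\sqcup,0,1\rangle$ such that $\langle A,\sqcap,\sqcup,0,1\rangle$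 is a lattice with minimum $0$ and maximum $1$, $\langle A,*,1\rangle$ is a commutative monoid, $z*x\le y$ iff $z\le x\Rightarrow y$, and $(x\Rightarrow y)\sqcup(y\Rightarrow x)=1$, for all $x,y,z\in A$. Assignments interpret $\&,\wedge,\to,\bot$ by $*,\sqcap,\Rightarrow,0$; $\Gamma\models_A\varphi$ means that every assignment in $A$ giving all formulas of $\Gamma$ the value $1$ gives $\varphi$ the value $1$. An $L$-algebra is an MTL-algebra in which every added axiom of $L$ takes the value $1$ under every assignment; an $L$-chain is a totally ordered $L$-algebra (the one-element algebra is allowed). Embeddings are injective homomorphisms. \textbf{Properties.} \begin{itemize} \item The variety of $L$-algebras has the chain joint embedding property (CJEP) if for any two $L$-chains with more than one element there is an $L$-chain into which both embed. \item $L$ has the strong single chain completeness (SSCC) if there is an $L$-chain $A$ such that, for every set $\Gamma$ of formulas and every formula $\varphi$, $\Gamma\vdash_L\varphi$ iff $\Gamma\models_A\varphi$. \item $L$ is Halld\'en complete (HC) if for all formulas $\varphi,\psi$ with no variables in common, $\vdash_L\varphi\vee\psi$ implies $\vdash_L\varphi$ or $\vdash_L\psi$. \item $L$ has the deductive Maksimova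 variable separation property (DMVP) if for all sets of formulas $\Gamma\cup\{\varphi\}$ and $\Sigma\cup\{\psi\}$ with no variables in common, $\Gamma,\Sigma\vdash_L\varphi\vee\psi$ implies $\Gamma\vdash_L\varphi$ or $\Sigma\vdash_L\psi$. \item $L$ has the deductive pseudo-relevance property (DPRP) if for every set of formulas $\Gamma$ and every formula $\psi$ with no variables in common, $\Gamma\vdash_L\psi$ implies $\Gamma\vdash_L\bot$ or $\vdash_L\psi$. \item $L$ has the strong deductive pseudo-relevance property (SDPRP) if for all sets of formulas $\Gamma$ and $\Sigma\cup\{\psi\}$ with no variables in common, $\Gamma,\Sigma\vdash_L\psi$ implies $\Gamma\vdash_L\bot$ or $\Sigma\vdash_L\psi$. \end{itemize} \textbf{Theorem.} Let $L$ be an extension of MTL. \begin{itemize} \item If the variety of $L$-algebras has the CJEP, then $L$ has the SSCC, the HC, the DMVP and the SDPRP. \item If $L$ has the DMVP, then $L$ has the DPRP. \end{itemize} -/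

import Mathlib

universe u

namespace MTL

/-- Formulas over the primitive connectives `&`, `∧`, `→`, `⊥` and the variables `x₀, x₁, …`. -/
inductive Formula : Type
  | var (n : ℕ) : Formula
  | bot : Formula
  | conj (φ ψ : Formula) : Formula
  | meet (φ ψ : Formula) : Formula
  | imp (φ ψ : Formula) : Formula

namespace Formula

/-- The derived connective `φ ∨ ψ := ((φ → ψ) → ψ) ∧ ((ψ → φ) → φ)`. -/
def disj (φ ψ : Formula) : Formula :=
  meet (imp (imp φ ψ) ψ) (imp (imp ψ φ) φ)

/-- The set of variables occurring in a formula. -/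
def vars : Formula → Set ℕ
  | var n => {n}
  | bot => ∅
  | conj φ ψ => φ.vars ∪ ψ.vars
  | meet φ ψ => φ.vars ∪ ψ.vars
  | imp φ ψ => φ.vars ∪ ψ.vars

/-- Uniform substitution of formulas for variables. -/
def subst (σ : ℕ → Formula) : Formula → Formula
  | var n => σ n
  | bot => bot
  | conj φ ψ => conj (φ.subst σ) (ψ.subst σ)
  | meet φ ψ => meet (φ.subst σ) (ψ.subst σ)
  | imp φ ψ => imp (φ.subst σ) (ψ.subst σ)

end Formula

open Formula

/-- The set of variables occurring in a set of formulas. -/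
def varsOf (Γ : Set Formula) : Set ℕ := ⋃ φ ∈ Γ, φ.vars

/-- The axiom schemata of MTL. -/
inductive IsAxiom : Formula → Prop
  | a1 (φ ψ χ : Formula) : IsAxiom (imp (imp φ ψ) (imp (imp ψ χ) (imp φ χ)))
  | a2 (φ ψ : Formula) : IsAxiom (imp (conj φ ψ) φ)
  | a3 (φ ψ : Formula) : IsAxiom (imp (conj φ ψ) (conj ψ φ))
  | a4 (φ ψ : Formula) : IsAxiom (imp (meet φ ψ) φ)
  | a5 (φ ψ : Formula) : IsAxiom (imp (meet φ ψ) (meet ψ φ))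
  | a6 (φ ψ : Formula) : IsAxiom (imp (conj φ (imp φ ψ)) (meet ψ φ))
  | a7a (φ ψ χ : Formula) : IsAxiom (imp (imp φ (imp ψ χ)) (imp (conj φ ψ) χ))
  | a7b (φ ψ χ : Formula) : IsAxiom (imp (imp (conj φ ψ) χ) (imp φ (imp ψ χ)))
  | a8 (φ ψ χ : Formula) :
      IsAxiom (imp (imp (imp φ ψ) χ) (imp (imp (imp ψ φ) χ) χ))
  | a9 (φ : Formula) : IsAxiom (imp bot φ)

/-- `Provable L Γ φ` is `Γ ⊢_L φ`, where the axiomatic extension of MTL is presented by the set `L`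
of the added axioms, read as schemata: all their substitution instances are axioms.
The only rule is modus ponens. -/
inductive Provable (L : Set Formula) (Γ : Set Formula) : Formula → Prop
  | hyp {φ : Formula} : φ ∈ Γ → Provable L Γ φ
  | mtl {φ : Formula} : IsAxiom φ → Provable L Γ φ
  | ext {φ : Formula} (σ : ℕ → Formula) : φ ∈ L → Provable L Γ (φ.subst σ)
  | mp {φ ψ : Formula} : Provable L Γ φ → Provable L Γ (imp φ ψ) → Provable L Γ ψ

/-- MTL-algebras: bounded integral commutative residuated lattices with prelinearity.
The one-element algebra is allowed. -/
class MTLAlgebra (A : Type u) extends Lattice A, BoundedOrder A, CommMonoid A, HImp A where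
  one_eq_top : (1 : A) = ⊤
  residuation : ∀ x y z : A, z * x ≤ y ↔ z ≤ x ⇨ y
  prelinearity : ∀ x y : A, (x ⇨ y) ⊔ (y ⇨ x) = 1

/-- The value of a formula under an assignment `v` of its variables in an MTL-algebra. -/
def eval {A : Type u} [MTLAlgebra A] (v : ℕ → A) : Formula → A
  | var n => v n
  | bot => ⊥
  | conj φ ψ => eval v φ * eval v ψ
  | meet φ ψ => eval v φ ⊓ eval v ψ
  | imp φ ψ => eval v φ ⇨ eval v ψ

/-- `Γ ⊨_A φ`: every assignment in `A` that models `Γ` gives `φ` the value `1`. -/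
def Entails (A : Type u) [MTLAlgebra A] (Γ : Set Formula) (φ : Formula) : Prop :=
  ∀ v : ℕ → A, (∀ γ ∈ Γ, eval v γ = 1) → eval v φ = 1

/-- `A` belongs to the variety of `L`-algebras: all the added axioms are valid in `A`. -/
def IsLAlgebra (L : Set Formula) (A : Type u) [MTLAlgebra A] : Prop :=
  ∀ φ ∈ L, ∀ v : ℕ → A, eval v φ = 1

/-- `A` is an `L`-chain: a totally ordered `L`-algebra. -/
def IsLChain (L : Set Formula) (A : Type u) [MTLAlgebra A] : Prop :=
  IsLAlgebra L A ∧ ∀ x y : A, x ≤ y ∨ y ≤ x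

/-- Embeddings of MTL-algebras: injective homomorphisms for all the operations. -/
structure IsEmbedding {A B : Type u} [MTLAlgebra A] [MTLAlgebra B] (f : A → B) : Prop where
  injective : Function.Injective f
  map_mul : ∀ x y, f (x * y) = f x * f y
  map_himp : ∀ x y, f (x ⇨ y) = f x ⇨ f y
  map_inf : ∀ x y, f (x ⊓ y) = f x ⊓ f y
  map_sup : ∀ x y, f (x ⊔ y) = f x ⊔ f y
  map_bot : f ⊥ = ⊥
  map_one : f 1 = 1

/-- Chain joint embedding property: any two nontrivial `L`-chains embed into a common `L`-chain.
(The one-element chain embeds into no nontrivial algebra, as embeddings preserve `0` and `1`;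
so it has to be left out here.) -/
def CJEP (L : Set Formula) : Prop :=
  ∀ (A B : Type u) [MTLAlgebra A] [MTLAlgebra B] [Nontrivial A] [Nontrivial B],
    IsLChain L A → IsLChain L B →
      ∃ (C : Type u) (_ : MTLAlgebra C), IsLChain L C ∧
        (∃ f : A → C, IsEmbedding f) ∧ (∃ g : B → C, IsEmbedding g)

/-- Strong single chain completeness. -/
def SSCC (L : Set Formula) : Prop :=
  ∃ (A : Type u) (_ : MTLAlgebra A), IsLChain L A ∧
    ∀ (Γ : Set Formula) (φ : Formula), Provable L Γ φ ↔ Entails A Γ φ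

/-- Halldén completeness. -/
def HC (L : Set Formula) : Prop :=
  ∀ φ ψ : Formula, Disjoint φ.vars ψ.vars →
    Provable L ∅ (φ.disj ψ) → Provable L ∅ φ ∨ Provable L ∅ ψ

/-- Deductive Maksimova's variable separation property. -/
def DMVP (L : Set Formula) : Prop :=
  ∀ (Γ Δ : Set Formula) (φ ψ : Formula), Disjoint (varsOf (Γ ∪ {φ})) (varsOf (Δ ∪ {ψ})) →
    Provable L (Γ ∪ Δ) (φ.disj ψ) → Provable L Γ φ ∨ Provable L Δ ψ

/-- Deductive pseudo-relevance property. -/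
def DPRP (L : Set Formula) : Prop :=
  ∀ (Γ : Set Formula) (ψ : Formula), Disjoint (varsOf Γ) ψ.vars →
    Provable L Γ ψ → Provable L Γ bot ∨ Provable L ∅ ψ

/-- Strong deductive pseudo-relevance property. -/
def SDPRP (L : Set Formula) : Prop :=
  ∀ (Γ Δ : Set Formula) (ψ : Formula), Disjoint (varsOf Γ) (varsOf (Δ ∪ {ψ})) →
    Provable L (Γ ∪ Δ) ψ → Provable L Γ bot ∨ Provable L Δ ψ

end MTL

namespace MTL

open Formula Filter

/-! ### Basic facts on MTL-algebras -/

section Algebra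

variable {A : Type u} [MTLAlgebra A]

/-! Every failed derivation is witnessed in an `L`-chain (`exists_chain_of_not_provable`): the
Lindenbaum algebra of the premises is divided by a prime filter omitting the class of the
conclusion. The conclusion gets a value other than `1`, so this chain is nontrivial and the CJEP
applies to it.

For the DMVP, embed a chain refuting `φ` from `Γ` and one refuting `ψ` from `Δ` into a common chain.
Since no variable is shared, the two assignments glue to one, and a disjunction is `1` in a chain
only if a disjunct is. The HC is the case without premises, the SDPRP the case `φ = ⊥`, and the DPRP
is the SDPRP with `Δ = ∅`.

For the SSCC, one chain must refute all failed derivations at once. The CJEP extends by induction to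
finite families of chains, and an ultraproduct over the finite subfamilies handles arbitrary ones
(`CJEP.exists_chain`).

Lindenbaum algebras, filter quotients and ultraproducts are all quotients of a preordered structure,
so `PreMTLAlgebra` checks the algebra laws once for all three. -/

theorem le_one_of (x : A) : x ≤ 1 := by
  rw [MTLAlgebra.one_eq_top]; exact le_top

theorem eq_one_of_le {x : A} (h : 1 ≤ x) : x = 1 := le_antisymm (le_one_of x) h

theorem himp_eq_one {x y : A} : x ⇨ y = 1 ↔ x ≤ y := by
  constructor
  · intro h
    have := (MTLAlgebra.residuation x y 1).2 h.ge
    rwa [one_mul] at this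
  · intro h
    exact eq_one_of_le ((MTLAlgebra.residuation x y 1).1 (by rwa [one_mul]))

theorem himp_mul_le (x y : A) : (x ⇨ y) * x ≤ y := (MTLAlgebra.residuation x y _).2 le_rfl

theorem mul_mono_left {x x' : A} (y : A) (h : x ≤ x') : x * y ≤ x' * y :=
  (MTLAlgebra.residuation _ _ _).2 (h.trans ((MTLAlgebra.residuation _ _ _).1 le_rfl))

theorem mul_mono {x x' y y' : A} (h : x ≤ x') (h' : y ≤ y') : x * y ≤ x' * y' := by
  refine (mul_mono_left y h).trans ?_
  rw [mul_comm x' y, mul_comm x' y']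
  exact mul_mono_left x' h'

theorem mul_le_left (x y : A) : x * y ≤ x := by
  simpa using mul_mono (le_refl x) (le_one_of y)

theorem mul_le_right (x y : A) : x * y ≤ y := by
  simpa using mul_mono (le_one_of x) (le_refl y)

theorem one_himp_eq (x : A) : (1 : A) ⇨ x = x := by
  apply le_antisymm
  · simpa using himp_mul_le 1 x
  · exact (MTLAlgebra.residuation _ _ _).1 (by rw [mul_one])

/-- Multiplication by `x` has a right adjoint, hence preserves joins. -/
theorem mul_sup_le {x y z w : A} (h : x * y ≤ w) (h' : x * z ≤ w) : x * (y ⊔ z) ≤ w := by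
  rw [mul_comm] at h h' ⊢
  exact (MTLAlgebra.residuation _ _ _).2
    (sup_le ((MTLAlgebra.residuation _ _ _).1 h) ((MTLAlgebra.residuation _ _ _).1 h'))

/-- Expand `(x ⊔ y) * (x ⊔ z)`: every term except `y * z` lies below `x`. -/
theorem sup_mul_eq_one {x y z : A} (h : x ⊔ y = 1) (h' : x ⊔ z = 1) : x ⊔ y * z = 1 := by
  apply eq_one_of_le
  calc (1 : A) = (x ⊔ y) * (x ⊔ z) := by rw [h, h', one_mul]
    _ ≤ x ⊔ y * z := by
      refine mul_sup_le (le_sup_of_le_left (mul_le_right _ _)) ?_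
      rw [mul_comm]
      refine mul_sup_le (le_sup_of_le_left (mul_le_right _ _)) ?_
      rw [mul_comm]
      exact le_sup_right

theorem sup_pow_eq_one {x y : A} (h : x ⊔ y = 1) (n : ℕ) : x ⊔ y ^ n = 1 := by
  induction n with
  | zero => rw [pow_zero]; exact eq_one_of_le le_sup_right
  | succ n ih => rw [pow_succ]; exact sup_mul_eq_one ih h

theorem pow_sup_pow_eq_one {x y : A} (h : x ⊔ y = 1) (m n : ℕ) : x ^ m ⊔ y ^ n = 1 := by
  rw [sup_comm]
  apply sup_pow_eq_one
  rw [sup_comm]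
  exact sup_pow_eq_one h n

theorem himp_mul_himp_le (x y z : A) : (x ⇨ y) * (y ⇨ z) ≤ x ⇨ z := by
  apply (MTLAlgebra.residuation _ _ _).1
  calc (x ⇨ y) * (y ⇨ z) * x = (y ⇨ z) * ((x ⇨ y) * x) := by
        rw [mul_comm (x ⇨ y), mul_assoc]
    _ ≤ (y ⇨ z) * y := mul_mono le_rfl (himp_mul_le _ _)
    _ ≤ z := himp_mul_le _ _

theorem himp_himp_eq (x y z : A) : x ⇨ y ⇨ z = x * y ⇨ z := by
  apply eq_of_forall_le_iff
  intro w
  rw [← MTLAlgebra.residuation, ← MTLAlgebra.residuation, ← MTLAlgebra.residuation, mul_assoc]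

theorem eval_eq_one_of_isAxiom {φ : Formula} (h : IsAxiom φ) (v : ℕ → A) : eval v φ = 1 := by
  cases h with
  | a1 φ ψ χ =>
    apply himp_eq_one.2
    exact (MTLAlgebra.residuation _ _ _).1 (himp_mul_himp_le _ _ _)
  | a2 φ ψ => exact himp_eq_one.2 (mul_le_left _ _)
  | a3 φ ψ => exact himp_eq_one.2 (mul_comm _ _).le
  | a4 φ ψ => exact himp_eq_one.2 inf_le_left
  | a5 φ ψ => exact himp_eq_one.2 (inf_comm _ _).le
  | a6 φ ψ =>
    refine himp_eq_one.2 (le_inf ?_ (mul_le_left _ _))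
    exact (mul_comm _ _).le.trans (himp_mul_le _ _)
  | a7a φ ψ χ => exact himp_eq_one.2 (himp_himp_eq _ _ _).le
  | a7b φ ψ χ => exact himp_eq_one.2 (himp_himp_eq _ _ _).ge
  | a8 φ ψ χ =>
    apply himp_eq_one.2
    apply (MTLAlgebra.residuation _ _ _).1
    rw [← mul_one (_ * _), ← MTLAlgebra.prelinearity (eval v φ) (eval v ψ)]
    apply mul_sup_le
    · exact (mul_mono_left _ (mul_le_left _ _)).trans (himp_mul_le _ _)
    · exact (mul_mono_left _ (mul_le_right _ _)).trans (himp_mul_le _ _)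
  | a9 φ => exact himp_eq_one.2 bot_le

theorem eval_subst (v : ℕ → A) (σ : ℕ → Formula) (φ : Formula) :
    eval v (φ.subst σ) = eval (fun n => eval v (σ n)) φ := by
  induction φ <;> simp_all [eval, Formula.subst]

/-- Soundness. -/
theorem Provable.entails {L Γ : Set Formula} {φ : Formula} (h : Provable L Γ φ)
    (hA : IsLAlgebra L A) : Entails A Γ φ := by
  intro v hv
  induction h with
  | hyp h => exact hv _ h
  | mtl h => exact eval_eq_one_of_isAxiom h v
  | ext σ h => rw [eval_subst]; exact hA _ h _
  | mp _ _ ih₁ ih₂ =>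
    have := himp_eq_one.1 ih₂
    rw [ih₁] at this
    exact eq_one_of_le this

theorem eval_congr {v w : ℕ → A} {φ : Formula} (h : ∀ n ∈ φ.vars, v n = w n) :
    eval v φ = eval w φ := by
  induction φ with
  | var n => exact h n rfl
  | bot => rfl
  | conj φ ψ ih₁ ih₂ | meet φ ψ ih₁ ih₂ | imp φ ψ ih₁ ih₂ =>
    simp only [eval]
    rw [ih₁ fun n hn => h n (Or.inl hn), ih₂ fun n hn => h n (Or.inr hn)]

theorem IsEmbedding.map_eval {B : Type u} [MTLAlgebra B] {f : A → B} (hf : IsEmbedding f)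
    (v : ℕ → A) (φ : Formula) : f (eval v φ) = eval (fun n => f (v n)) φ := by
  induction φ with
  | var n => rfl
  | bot => exact hf.map_bot
  | conj φ ψ ih₁ ih₂ => simp only [eval, hf.map_mul, ih₁, ih₂]
  | meet φ ψ ih₁ ih₂ => simp only [eval, hf.map_inf, ih₁, ih₂]
  | imp φ ψ ih₁ ih₂ => simp only [eval, hf.map_himp, ih₁, ih₂]

theorem IsEmbedding.eval_eq_one_iff {B : Type u} [MTLAlgebra B] {f : A → B} (hf : IsEmbedding f)
    (v : ℕ → A) (φ : Formula) : eval (fun n => f (v n)) φ = 1 ↔ eval v φ = 1 := by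
  rw [← hf.map_eval, ← hf.map_one, hf.injective.eq_iff]

theorem IsEmbedding.id : IsEmbedding (fun x : A => x) :=
  ⟨fun _ _ h => h, fun _ _ => rfl, fun _ _ => rfl, fun _ _ => rfl, fun _ _ => rfl, rfl, rfl⟩

theorem IsEmbedding.comp {B C : Type u} [MTLAlgebra B] [MTLAlgebra C] {g : B → C} {f : A → B}
    (hg : IsEmbedding g) (hf : IsEmbedding f) : IsEmbedding (fun x => g (f x)) where
  injective := hg.injective.comp hf.injective
  map_mul x y := by rw [hf.map_mul, hg.map_mul]
  map_himp x y := by rw [hf.map_himp, hg.map_himp]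
  map_inf x y := by rw [hf.map_inf, hg.map_inf]
  map_sup x y := by rw [hf.map_sup, hg.map_sup]
  map_bot := by rw [hf.map_bot, hg.map_bot]
  map_one := by rw [hf.map_one, hg.map_one]

/-- In a chain, a disjunction takes the value `1` only if one of the disjuncts does. -/
theorem eval_disj_eq_one (hA : ∀ x y : A, x ≤ y ∨ y ≤ x) {v : ℕ → A} {φ ψ : Formula}
    (h : eval v (φ.disj ψ) = 1) : eval v φ = 1 ∨ eval v ψ = 1 := by
  have h' : ((eval v φ ⇨ eval v ψ) ⇨ eval v ψ) ⊓ ((eval v ψ ⇨ eval v φ) ⇨ eval v φ) = 1 := h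
  -- The implication between the comparable values is `1`, so one conjunct collapses to the larger
  -- value.
  rcases hA (eval v φ) (eval v ψ) with hle | hle
  · right
    apply eq_one_of_le
    rw [← h', himp_eq_one.2 hle, one_himp_eq]
    exact inf_le_left
  · left
    apply eq_one_of_le
    rw [← h', himp_eq_one.2 hle, one_himp_eq]
    exact inf_le_right

end Algebra

/-! ### MTL-algebras from preorders -/

/-- A preorder with operations that satisfy the laws of MTL-algebras up to equivalence. -/
structure PreMTLAlgebra (X : Type u) where
  le : X → X → Prop
  mul : X → X → X
  imp : X → X → X
  inf : X → X → X
  sup : X → X → X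
  bot : X
  one : X
  le_refl : ∀ x, le x x
  le_trans : ∀ {x y z}, le x y → le y z → le x z
  inf_le_left : ∀ x y, le (inf x y) x
  inf_le_right : ∀ x y, le (inf x y) y
  le_inf : ∀ {x y z}, le x y → le x z → le x (inf y z)
  le_sup_left : ∀ x y, le x (sup x y)
  le_sup_right : ∀ x y, le y (sup x y)
  sup_le : ∀ {x y z}, le x z → le y z → le (sup x y) z
  bot_le : ∀ x, le bot x
  le_one : ∀ x, le x one
  mul_comm : ∀ x y, le (mul x y) (mul y x)
  mul_assoc : ∀ x y z, le (mul (mul x y) z) (mul x (mul y z))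
  mul_le_left : ∀ x y, le (mul x y) x
  le_mul_one : ∀ x, le x (mul x one)
  residuation : ∀ x y z, le (mul z x) y ↔ le z (imp x y)
  prelinearity : ∀ x y, le one (sup (imp x y) (imp y x))

namespace PreMTLAlgebra

variable {X : Type u} (P : PreMTLAlgebra X)

theorem mul_le_mul_right {x x' : X} (y : X) (h : P.le x x') : P.le (P.mul x y) (P.mul x' y) :=
  (P.residuation _ _ _).2 (P.le_trans h ((P.residuation _ _ _).1 (P.le_refl _)))

theorem mul_le_mul {x x' y y' : X} (h : P.le x x') (h' : P.le y y') :
    P.le (P.mul x y) (P.mul x' y') :=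
  P.le_trans (P.mul_le_mul_right y h) <| P.le_trans (P.mul_comm _ _) <|
    P.le_trans (P.mul_le_mul_right x' h') (P.mul_comm _ _)

theorem imp_le_imp {x x' y y' : X} (h : P.le x' x) (h' : P.le y y') :
    P.le (P.imp x y) (P.imp x' y') :=
  (P.residuation _ _ _).1 <| P.le_trans (P.mul_le_mul (P.le_refl _) h) <|
    P.le_trans ((P.residuation _ _ _).2 (P.le_refl _)) h'

/-- The equivalence induced by the preorder. -/
def setoid : Setoid X where
  r x y := P.le x y ∧ P.le y x
  iseqv := ⟨fun x => ⟨P.le_refl x, P.le_refl x⟩, fun h => ⟨h.2, h.1⟩,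
    fun h h' => ⟨P.le_trans h.1 h'.1, P.le_trans h'.2 h.2⟩⟩

/-- The MTL-algebra of the equivalence classes. -/
def Quot : Type u := Quotient P.setoid

/-- The equivalence class of an element. -/
def toQuot (x : X) : P.Quot := Quotient.mk P.setoid x

theorem toQuot_eq_toQuot {x y : X} : P.toQuot x = P.toQuot y ↔ P.le x y ∧ P.le y x :=
  Quotient.eq (r := P.setoid)

theorem toQuot_surjective : Function.Surjective P.toQuot := Quotient.mk_surjective

instance : MTLAlgebra P.Quot where
  le := Quotient.lift₂ (s₁ := P.setoid) (s₂ := P.setoid) P.le fun _ _ _ _ h h' => propext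
    ⟨fun k => P.le_trans h.2 (P.le_trans k h'.1), fun k => P.le_trans h.1 (P.le_trans k h'.2)⟩
  mul := Quotient.map₂ (sa := P.setoid) (sb := P.setoid) (sc := P.setoid) P.mul fun _ _ h _ _ h' =>
    ⟨P.mul_le_mul h.1 h'.1, P.mul_le_mul h.2 h'.2⟩
  himp := Quotient.map₂ (sa := P.setoid) (sb := P.setoid) (sc := P.setoid) P.imp
    fun _ _ h _ _ h' => ⟨P.imp_le_imp h.2 h'.1, P.imp_le_imp h.1 h'.2⟩
  inf := Quotient.map₂ (sa := P.setoid) (sb := P.setoid) (sc := P.setoid) P.inf fun x y h x' y' h' =>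
    ⟨P.le_inf (P.le_trans (P.inf_le_left _ _) h.1) (P.le_trans (P.inf_le_right _ _) h'.1),
      P.le_inf (P.le_trans (P.inf_le_left _ _) h.2) (P.le_trans (P.inf_le_right _ _) h'.2)⟩
  sup := Quotient.map₂ (sa := P.setoid) (sb := P.setoid) (sc := P.setoid) P.sup fun x y h x' y' h' =>
    ⟨P.sup_le (P.le_trans h.1 (P.le_sup_left _ _)) (P.le_trans h'.1 (P.le_sup_right _ _)),
      P.sup_le (P.le_trans h.2 (P.le_sup_left _ _)) (P.le_trans h'.2 (P.le_sup_right _ _))⟩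
  one := P.toQuot P.one
  top := P.toQuot P.one
  bot := P.toQuot P.bot
  le_refl := by rintro ⟨x⟩; exact P.le_refl x
  le_trans := by rintro ⟨x⟩ ⟨y⟩ ⟨z⟩; exact P.le_trans
  le_antisymm := by rintro ⟨x⟩ ⟨y⟩ h h'; exact P.toQuot_eq_toQuot.2 ⟨h, h'⟩
  inf_le_left := by rintro ⟨x⟩ ⟨y⟩; exact P.inf_le_left x y
  inf_le_right := by rintro ⟨x⟩ ⟨y⟩; exact P.inf_le_right x y
  le_inf := by rintro ⟨x⟩ ⟨y⟩ ⟨z⟩; exact P.le_inf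
  le_sup_left := by rintro ⟨x⟩ ⟨y⟩; exact P.le_sup_left x y
  le_sup_right := by rintro ⟨x⟩ ⟨y⟩; exact P.le_sup_right x y
  sup_le := by rintro ⟨x⟩ ⟨y⟩ ⟨z⟩; exact P.sup_le
  le_top := by rintro ⟨x⟩; exact P.le_one x
  bot_le := by rintro ⟨x⟩; exact P.bot_le x
  mul_comm := by rintro ⟨x⟩ ⟨y⟩; exact P.toQuot_eq_toQuot.2 ⟨P.mul_comm x y, P.mul_comm y x⟩
  mul_assoc := by
    rintro ⟨x⟩ ⟨y⟩ ⟨z⟩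
    refine P.toQuot_eq_toQuot.2 ⟨P.mul_assoc x y z, ?_⟩
    -- Only one half of associativity is assumed; commutativity yields the other.
    refine P.le_trans (P.mul_comm _ _) ?_
    refine P.le_trans (P.mul_le_mul_right _ (P.mul_comm _ _)) ?_
    refine P.le_trans (P.mul_assoc _ _ _) ?_
    exact P.le_trans (P.mul_comm _ _) (P.mul_le_mul_right _ (P.mul_comm _ _))
  one_mul := by
    rintro ⟨x⟩
    exact P.toQuot_eq_toQuot.2 ⟨P.le_trans (P.mul_comm _ _) (P.mul_le_left _ _),
      P.le_trans (P.le_mul_one x) (P.mul_comm _ _)⟩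
  mul_one := by
    rintro ⟨x⟩
    exact P.toQuot_eq_toQuot.2 ⟨P.mul_le_left _ _, P.le_mul_one x⟩
  one_eq_top := rfl
  residuation := by rintro ⟨x⟩ ⟨y⟩ ⟨z⟩; exact P.residuation x y z
  prelinearity := by
    rintro ⟨x⟩ ⟨y⟩
    exact P.toQuot_eq_toQuot.2 ⟨P.le_one _, P.prelinearity x y⟩

theorem toQuot_eq_one {x : X} : P.toQuot x = 1 ↔ P.le P.one x :=
  P.toQuot_eq_toQuot.trans ⟨fun h => h.2, fun h => ⟨P.le_one x, h⟩⟩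

/-- Evaluation in the quotient commutes with a map that respects the connectives. -/
theorem eval_toQuot (e : Formula → X) (hbot : e Formula.bot = P.bot)
    (hconj : ∀ φ ψ, e (conj φ ψ) = P.mul (e φ) (e ψ))
    (hmeet : ∀ φ ψ, e (meet φ ψ) = P.inf (e φ) (e ψ))
    (himp : ∀ φ ψ, e (Formula.imp φ ψ) = P.imp (e φ) (e ψ)) (φ : Formula) :
    eval (fun n => P.toQuot (e (var n))) φ = P.toQuot (e φ) := by
  induction φ with
  | var n => rfl
  | bot => rw [hbot]; rfl
  | conj φ ψ ih₁ ih₂ => rw [eval, ih₁, ih₂, hconj]; rfl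
  | meet φ ψ ih₁ ih₂ => rw [eval, ih₁, ih₂, hmeet]; rfl
  | imp φ ψ ih₁ ih₂ => rw [eval, ih₁, ih₂, himp]; rfl

theorem quot_le_total (h : ∀ x y, P.le x y ∨ P.le y x) (a b : P.Quot) : a ≤ b ∨ b ≤ a := by
  obtain ⟨x, rfl⟩ := P.toQuot_surjective a
  obtain ⟨y, rfl⟩ := P.toQuot_surjective b
  exact h x y

end PreMTLAlgebra

/-! ### The Lindenbaum algebra of a theory -/

namespace Provable

variable {L Γ : Set Formula} {φ ψ χ : Formula}

theorem imp_trans (h : Provable L Γ (imp φ ψ)) (h' : Provable L Γ (imp ψ χ)) :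
    Provable L Γ (imp φ χ) :=
  mp h' (mp h (mtl (.a1 _ _ _)))

theorem curry (h : Provable L Γ (imp (conj φ ψ) χ)) : Provable L Γ (imp φ (imp ψ χ)) :=
  mp h (mtl (.a7b _ _ _))

theorem uncurry (h : Provable L Γ (imp φ (imp ψ χ))) : Provable L Γ (imp (conj φ ψ) χ) :=
  mp h (mtl (.a7a _ _ _))

theorem imp_swap (h : Provable L Γ (imp φ (imp ψ χ))) : Provable L Γ (imp ψ (imp φ χ)) :=
  curry (imp_trans (mtl (.a3 _ _)) (uncurry h))

theorem imp_imp_left (φ ψ : Formula) : Provable L Γ (imp φ (imp ψ φ)) :=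
  curry (mtl (.a2 _ _))

theorem imp_of (ψ : Formula) (h : Provable L Γ φ) : Provable L Γ (imp ψ φ) :=
  mp h (imp_imp_left φ ψ)

/-- Weaken `φ` by the axiom `⊥ → φ`, swap the premises and detach that axiom. -/
theorem imp_self (φ : Formula) : Provable L Γ (imp φ φ) :=
  mp (mtl (.a9 φ)) (imp_swap (imp_imp_left φ (imp bot φ)))

theorem imp_mp (φ ψ : Formula) : Provable L Γ (imp φ (imp (imp φ ψ) ψ)) :=
  imp_swap (imp_self _)

theorem cases_imp (h : Provable L Γ (imp (imp φ ψ) χ)) (h' : Provable L Γ (imp (imp ψ φ) χ)) :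
    Provable L Γ χ :=
  mp h' (mp h (mtl (.a8 _ _ _)))

theorem meet_imp_right (φ ψ : Formula) : Provable L Γ (imp (meet φ ψ) ψ) :=
  imp_trans (mtl (.a5 _ _)) (mtl (.a4 _ _))

/-- By prelinearity one may assume `φ → ψ` or `ψ → φ`; divisibility-style axiom `a6` then produces
the meet from the smaller formula alone. -/
theorem imp_meet (h : Provable L Γ (imp χ φ)) (h' : Provable L Γ (imp χ ψ)) :
    Provable L Γ (imp χ (meet φ ψ)) :=
  cases_imp (imp_swap (imp_trans h (curry (imp_trans (mtl (.a6 φ ψ)) (mtl (.a5 _ _))))))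
    (imp_swap (imp_trans h' (curry (mtl (.a6 ψ φ)))))

theorem imp_disj_left (φ ψ : Formula) : Provable L Γ (imp φ (disj φ ψ)) :=
  imp_meet (imp_mp _ _) (imp_imp_left _ _)

theorem imp_disj_right (φ ψ : Formula) : Provable L Γ (imp ψ (disj φ ψ)) :=
  imp_meet (imp_imp_left _ _) (imp_mp _ _)

/-- Under `φ → ψ` the first conjunct of the disjunction yields `ψ`; under `ψ → φ` the second yields
`φ`. -/
theorem disj_imp (h : Provable L Γ (imp φ χ)) (h' : Provable L Γ (imp ψ χ)) :
    Provable L Γ (imp (disj φ ψ) χ) :=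
  cases_imp (imp_swap (curry (imp_trans (uncurry (mtl (.a4 _ _))) h')))
    (imp_swap (curry (imp_trans (uncurry (meet_imp_right _ _)) h)))

theorem conj_assoc (φ ψ χ : Formula) :
    Provable L Γ (imp (conj (conj φ ψ) χ) (conj φ (conj ψ χ))) :=
  uncurry (uncurry (imp_trans (curry (imp_self _)) (mtl (.a7b _ _ _))))

theorem iff_of_imp_top (φ : Formula) : Provable L Γ (imp (imp bot bot) φ) ↔ Provable L Γ φ :=
  ⟨fun h => mp (imp_self _) h, imp_of _⟩

end Provable

/-- The formulas ordered by provable implication from `Γ`. -/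
def provablePreMTLAlgebra (L Γ : Set Formula) : PreMTLAlgebra (ULift.{u} Formula) where
  le φ ψ := Provable L Γ (imp φ.down ψ.down)
  mul φ ψ := ⟨conj φ.down ψ.down⟩
  imp φ ψ := ⟨imp φ.down ψ.down⟩
  inf φ ψ := ⟨meet φ.down ψ.down⟩
  sup φ ψ := ⟨disj φ.down ψ.down⟩
  bot := ⟨bot⟩
  one := ⟨imp bot bot⟩
  le_refl _ := .imp_self _
  le_trans := .imp_trans
  inf_le_left _ _ := .mtl (.a4 _ _)
  inf_le_right _ _ := .meet_imp_right _ _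
  le_inf := .imp_meet
  le_sup_left _ _ := .imp_disj_left _ _
  le_sup_right _ _ := .imp_disj_right _ _
  sup_le := .disj_imp
  bot_le _ := .mtl (.a9 _)
  le_one _ := .imp_of _ (.imp_self _)
  mul_comm _ _ := .mtl (.a3 _ _)
  mul_assoc _ _ _ := .conj_assoc _ _ _
  mul_le_left _ _ := .mtl (.a2 _ _)
  le_mul_one φ := .mp (.imp_self bot) (.imp_swap (.curry (.imp_self (conj φ.down (imp bot bot)))))
  residuation _ _ _ := ⟨.curry, .uncurry⟩
  prelinearity _ _ := .imp_of _ (.cases_imp (.imp_disj_left _ _) (.imp_disj_right _ _))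

/-- The Lindenbaum algebra of the theory axiomatized by `Γ`. -/
abbrev Lindenbaum (L Γ : Set Formula) : Type u := (provablePreMTLAlgebra.{u} L Γ).Quot

/-- Choosing representatives turns an assignment into a substitution, and instances of added axioms
are derivable. -/
theorem isLAlgebra_lindenbaum (L Γ : Set Formula) : IsLAlgebra L (Lindenbaum.{u} L Γ) := by
  intro φ hφ v
  choose σ hσ using fun n => (provablePreMTLAlgebra.{u} L Γ).toQuot_surjective (v n)
  have h := (provablePreMTLAlgebra.{u} L Γ).eval_toQuot
    (fun φ => ⟨φ.subst fun n => (σ n).down⟩) rfl (fun _ _ => rfl) (fun _ _ => rfl)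
    (fun _ _ => rfl) φ
  have hv : v = fun n => (provablePreMTLAlgebra.{u} L Γ).toQuot
      ⟨(var n).subst fun n => (σ n).down⟩ := funext fun n => (hσ n).symm
  rw [hv, h, PreMTLAlgebra.toQuot_eq_one]
  exact .imp_of _ (.ext _ hφ)

/-- The canonical assignment in the Lindenbaum algebra validates exactly the theorems. -/
theorem eval_lindenbaum_eq_one (L Γ : Set Formula) (φ : Formula) :
    eval (fun n => (provablePreMTLAlgebra.{u} L Γ).toQuot ⟨var n⟩) φ = 1 ↔ Provable L Γ φ := by
  rw [(provablePreMTLAlgebra.{u} L Γ).eval_toQuot (fun φ => ⟨φ⟩) rfl (fun _ _ => rfl)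
    (fun _ _ => rfl) (fun _ _ => rfl) φ, PreMTLAlgebra.toQuot_eq_one]
  exact Provable.iff_of_imp_top φ

/-! ### Filters -/

section Filters

variable {A : Type u} [MTLAlgebra A]

/-- Filters of an MTL-algebra. -/
structure IsFilter (F : Set A) : Prop where
  one_mem : 1 ∈ F
  mul_mem : ∀ {x y}, x ∈ F → y ∈ F → x * y ∈ F
  mem_of_le : ∀ {x y}, x ∈ F → x ≤ y → y ∈ F

/-- The filter generated by a filter and an element. -/
def adjoinFilter (F : Set A) (x : A) : Set A := {z | ∃ f ∈ F, ∃ n : ℕ, f * x ^ n ≤ z}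

theorem IsFilter.adjoin {F : Set A} (hF : IsFilter F) (x : A) : IsFilter (adjoinFilter F x) where
  one_mem := ⟨1, hF.one_mem, 0, le_one_of _⟩
  mul_mem := by
    rintro y z ⟨f, hf, m, hy⟩ ⟨g, hg, n, hz⟩
    refine ⟨f * g, hF.mul_mem hf hg, m + n, ?_⟩
    rw [pow_add, mul_mul_mul_comm]
    exact mul_mono hy hz
  mem_of_le := by
    rintro y z ⟨f, hf, m, hy⟩ h
    exact ⟨f, hf, m, hy.trans h⟩

theorem subset_adjoinFilter (F : Set A) (x : A) : F ⊆ adjoinFilter F x :=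
  fun f hf => ⟨f, hf, 0, by simp⟩

theorem IsFilter.mem_adjoinFilter {F : Set A} (hF : IsFilter F) (x : A) : x ∈ adjoinFilter F x :=
  ⟨1, hF.one_mem, 1, by simp⟩

/-- Prime filter theorem. -/
theorem exists_prime_filter {a : A} (ha : a ≠ 1) :
    ∃ F : Set A, IsFilter F ∧ a ∉ F ∧ ∀ x y : A, x ⇨ y ∈ F ∨ y ⇨ x ∈ F := by
  obtain ⟨F, -, hF⟩ := zorn_subset_nonempty {F : Set A | IsFilter F ∧ a ∉ F} (by
    intro c hc hchain hne
    refine ⟨⋃₀ c, ⟨⟨?_, ?_, ?_⟩, ?_⟩, fun s hs => Set.subset_sUnion_of_mem hs⟩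
    · obtain ⟨s, hs⟩ := hne
      exact ⟨s, hs, (hc hs).1.one_mem⟩
    · rintro x y ⟨s, hs, hx⟩ ⟨t, ht, hy⟩
      rcases hchain.total hs ht with h | h
      · exact ⟨t, ht, (hc ht).1.mul_mem (h hx) hy⟩
      · exact ⟨s, hs, (hc hs).1.mul_mem hx (h hy)⟩
    · rintro x y ⟨s, hs, hx⟩ h
      exact ⟨s, hs, (hc hs).1.mem_of_le hx h⟩
    · rintro ⟨s, hs, h⟩
      exact (hc hs).2 h) {1} (by
    refine ⟨⟨rfl, ?_, ?_⟩, ha⟩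
    · rintro x y rfl rfl
      exact mul_one 1
    · rintro x y rfl h
      exact eq_one_of_le h)
  obtain ⟨⟨hfil, haF⟩, hmax⟩ := hF
  -- By maximality, any proper enlargement of `F` captures `a`.
  have key : ∀ x, x ∉ F → a ∈ adjoinFilter F x := by
    intro x hx
    by_contra h
    exact hx (hmax ⟨hfil.adjoin x, h⟩ (subset_adjoinFilter F x) (hfil.mem_adjoinFilter x))
  refine ⟨F, hfil, haF, fun x y => ?_⟩
  by_contra! h
  obtain ⟨f, hf, m, hm⟩ := key _ h.1
  obtain ⟨g, hg, n, hn⟩ := key _ h.2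
  -- The powers of the two residua still have join `1`, so `f * g` distributes over that join and
  -- each part is below `a`.
  refine haF (hfil.mem_of_le (hfil.mul_mem hf hg) ?_)
  rw [← mul_one (f * g), ← pow_sup_pow_eq_one (MTLAlgebra.prelinearity x y) m n]
  exact mul_sup_le ((mul_mono_left _ (mul_le_left _ _)).trans hm)
    ((mul_mono_left _ (mul_le_right _ _)).trans hn)

/-- An MTL-algebra preordered by membership of residua in a filter. -/
def IsFilter.preMTLAlgebra {F : Set A} (hF : IsFilter F) : PreMTLAlgebra A :=
  have of_le {x y : A} (h : x ≤ y) : x ⇨ y ∈ F := by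
    rw [himp_eq_one.2 h]; exact hF.one_mem
  have iff {x y : A} : x ⇨ y ∈ F ↔ ∃ f ∈ F, f * x ≤ y :=
    ⟨fun h => ⟨_, h, himp_mul_le _ _⟩,
      fun ⟨_, hf, h⟩ => hF.mem_of_le hf ((MTLAlgebra.residuation _ _ _).1 h)⟩
  { le x y := x ⇨ y ∈ F
    mul x y := x * y
    imp x y := x ⇨ y
    inf x y := x ⊓ y
    sup x y := x ⊔ y
    bot := ⊥
    one := 1
    le_refl _ := of_le le_rfl
    le_trans h h' := hF.mem_of_le (hF.mul_mem h h') (himp_mul_himp_le _ _ _)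
    inf_le_left _ _ := of_le inf_le_left
    inf_le_right _ _ := of_le inf_le_right
    le_inf h h' := iff.2 ⟨_, hF.mul_mem h h',
      le_inf ((mul_mono_left _ (mul_le_left _ _)).trans (himp_mul_le _ _))
        ((mul_mono_left _ (mul_le_right _ _)).trans (himp_mul_le _ _))⟩
    le_sup_left _ _ := of_le le_sup_left
    le_sup_right _ _ := of_le le_sup_right
    sup_le h h' := iff.2 ⟨_, hF.mul_mem h h',
      mul_sup_le ((mul_mono_left _ (mul_le_left _ _)).trans (himp_mul_le _ _))
        ((mul_mono_left _ (mul_le_right _ _)).trans (himp_mul_le _ _))⟩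
    bot_le _ := of_le bot_le
    le_one _ := of_le (le_one_of _)
    mul_comm _ _ := of_le (mul_comm _ _).le
    mul_assoc _ _ _ := of_le (mul_assoc _ _ _).le
    mul_le_left _ _ := of_le (mul_le_left _ _)
    le_mul_one _ := of_le (mul_one _).ge
    residuation x y z := by rw [himp_himp_eq]
    prelinearity x y := of_le (MTLAlgebra.prelinearity x y).ge }

theorem IsFilter.eval_toQuot {F : Set A} (hF : IsFilter F) (v : ℕ → A) (φ : Formula) :
    eval (fun n => hF.preMTLAlgebra.toQuot (v n)) φ = hF.preMTLAlgebra.toQuot (eval v φ) :=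
  hF.preMTLAlgebra.eval_toQuot (eval v) rfl (fun _ _ => rfl) (fun _ _ => rfl) (fun _ _ => rfl) φ

theorem IsFilter.toQuot_eq_one {F : Set A} (hF : IsFilter F) {x : A} :
    hF.preMTLAlgebra.toQuot x = 1 ↔ x ∈ F := by
  rw [PreMTLAlgebra.toQuot_eq_one]
  change (1 : A) ⇨ x ∈ F ↔ x ∈ F
  rw [one_himp_eq]

theorem IsFilter.isLAlgebra_quot {F : Set A} (hF : IsFilter F) {L : Set Formula}
    (hA : IsLAlgebra L A) : IsLAlgebra L hF.preMTLAlgebra.Quot := by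
  intro φ hφ v
  choose w hw using fun n => hF.preMTLAlgebra.toQuot_surjective (v n)
  rw [show v = fun n => hF.preMTLAlgebra.toQuot (w n) from funext fun n => (hw n).symm, hF.eval_toQuot,
    hF.toQuot_eq_one, hA φ hφ w]
  exact hF.one_mem

end Filters

/-- Strong completeness with respect to chains. -/
theorem exists_chain_of_not_provable {L Γ : Set Formula} {φ : Formula} (h : ¬ Provable L Γ φ) :
    ∃ (A : Type u) (_ : MTLAlgebra A) (v : ℕ → A), IsLChain L A ∧ (∀ γ ∈ Γ, eval v γ = 1) ∧
      eval v φ ≠ 1 := by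
  obtain ⟨F, hF, hφ, hprime⟩ := exists_prime_filter
    (fun h' => h ((eval_lindenbaum_eq_one.{u} L Γ φ).1 h'))
  refine ⟨hF.preMTLAlgebra.Quot, inferInstance, fun n => hF.preMTLAlgebra.toQuot
    ((provablePreMTLAlgebra L Γ).toQuot ⟨var n⟩),
    ⟨hF.isLAlgebra_quot (isLAlgebra_lindenbaum L Γ), ?_⟩, fun γ hγ => ?_, ?_⟩
  · exact hF.preMTLAlgebra.quot_le_total hprime
  · rw [hF.eval_toQuot, (eval_lindenbaum_eq_one L Γ γ).2 (.hyp hγ)]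
    exact hF.toQuot_eq_one.2 hF.one_mem
  · rw [hF.eval_toQuot, Ne, hF.toQuot_eq_one]
    exact hφ

/-! ### Ultraproducts -/

section Ultraproduct

variable {I : Type} (U : Ultrafilter I) (C : I → Type u) [∀ i, MTLAlgebra (C i)]

/-- A product of MTL-algebras preordered by eventual inequality along an ultrafilter. -/
def ultraPreMTLAlgebra : PreMTLAlgebra (∀ i, C i) where
  le x y := ∀ᶠ i in U, x i ≤ y i
  mul x y i := x i * y i
  imp x y i := x i ⇨ y i
  inf x y i := x i ⊓ y i
  sup x y i := x i ⊔ y i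
  bot _ := ⊥
  one _ := 1
  le_refl _ := .of_forall fun _ => le_rfl
  le_trans h h' := by filter_upwards [h, h'] with i hi hi' using hi.trans hi'
  inf_le_left _ _ := .of_forall fun _ => inf_le_left
  inf_le_right _ _ := .of_forall fun _ => inf_le_right
  le_inf h h' := by filter_upwards [h, h'] with i hi hi' using le_inf hi hi'
  le_sup_left _ _ := .of_forall fun _ => le_sup_left
  le_sup_right _ _ := .of_forall fun _ => le_sup_right
  sup_le h h' := by filter_upwards [h, h'] with i hi hi' using sup_le hi hi'
  bot_le _ := .of_forall fun _ => bot_le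
  le_one _ := .of_forall fun _ => le_one_of _
  mul_comm _ _ := .of_forall fun _ => (mul_comm _ _).le
  mul_assoc _ _ _ := .of_forall fun _ => (mul_assoc _ _ _).le
  mul_le_left _ _ := .of_forall fun _ => mul_le_left _ _
  le_mul_one _ := .of_forall fun _ => (mul_one _).ge
  residuation _ _ _ := eventually_congr (.of_forall fun _ => MTLAlgebra.residuation _ _ _)
  prelinearity _ _ := .of_forall fun _ => (MTLAlgebra.prelinearity _ _).ge

theorem isLChain_ultraproduct {L : Set Formula} (hC : ∀ i, IsLChain L (C i)) :
    IsLChain L (ultraPreMTLAlgebra U C).Quot := by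
  refine ⟨fun φ hφ v => ?_, (ultraPreMTLAlgebra U C).quot_le_total fun x y => ?_⟩
  · choose w hw using fun n => (ultraPreMTLAlgebra U C).toQuot_surjective (v n)
    have h := (ultraPreMTLAlgebra U C).eval_toQuot (fun φ i => eval (fun n => w n i) φ) rfl
      (fun _ _ => rfl) (fun _ _ => rfl) (fun _ _ => rfl) φ
    rw [show v = fun n => (ultraPreMTLAlgebra U C).toQuot (fun i => eval (fun n => w n i) (var n))
      from funext fun n => (hw n).symm, h, PreMTLAlgebra.toQuot_eq_one]
    exact .of_forall fun i => ((hC i).1 φ hφ _).ge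
  -- Totality is where an ultrafilter, rather than a mere filter, is needed.
  · exact Ultrafilter.eventually_or.1 (.of_forall fun i => (hC i).2 (x i) (y i))

theorem isEmbedding_ultraproduct {A : Type u} [MTLAlgebra A] {f : ∀ i, A → C i}
    (hf : ∀ᶠ i in U, IsEmbedding (f i)) :
    IsEmbedding fun a => (ultraPreMTLAlgebra U C).toQuot fun i => f i a := by
  have mk_eq {x y : ∀ i, C i} (h : ∀ᶠ i in U, x i = y i) :
      (ultraPreMTLAlgebra U C).toQuot x = (ultraPreMTLAlgebra U C).toQuot y :=
    (ultraPreMTLAlgebra U C).toQuot_eq_toQuot.2 ⟨h.mono fun _ => le_of_eq, h.mono fun _ => ge_of_eq⟩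
  refine ⟨fun a b hab => ?_, fun _ _ => mk_eq (hf.mono fun _ h => h.map_mul _ _),
    fun _ _ => mk_eq (hf.mono fun _ h => h.map_himp _ _),
    fun _ _ => mk_eq (hf.mono fun _ h => h.map_inf _ _),
    fun _ _ => mk_eq (hf.mono fun _ h => h.map_sup _ _),
    mk_eq (hf.mono fun _ h => h.map_bot), mk_eq (hf.mono fun _ h => h.map_one)⟩
  obtain ⟨h₁, h₂⟩ := (ultraPreMTLAlgebra U C).toQuot_eq_toQuot.1 hab
  have h₁' : ∀ᶠ i in U, f i a ≤ f i b := h₁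
  have h₂' : ∀ᶠ i in U, f i b ≤ f i a := h₂
  -- A single index at which all three conditions hold suffices for injectivity.
  obtain ⟨i, hi, hle, hge⟩ := (hf.and (h₁'.and h₂')).exists
  exact hi.injective (le_antisymm hle hge)

end Ultraproduct

/-! ### Joint embeddings -/

/-- The one-element MTL-algebra. -/
instance : MTLAlgebra PUnit.{u + 1} where
  one_eq_top := rfl
  residuation _ _ _ := Iff.rfl
  prelinearity _ _ := rfl

theorem CJEP.exists_chain_finset {L : Set Formula} (hL : CJEP.{u} L) {I : Type} (A : I → Type u)
    [∀ i, MTLAlgebra (A i)] [∀ i, Nontrivial (A i)] (hA : ∀ i, IsLChain L (A i)) (s : Finset I) :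
    ∃ (C : Type u) (_ : MTLAlgebra C), IsLChain L C ∧
      ∀ i ∈ s, ∃ f : A i → C, IsEmbedding f := by
  classical
  induction s using Finset.induction_on with
  | empty =>
    exact ⟨PUnit, inferInstance, ⟨fun _ _ _ => rfl, fun _ _ => Or.inl le_rfl⟩, by simp⟩
  | insert i s _ ih =>
    obtain ⟨C, _, hC, hf⟩ := ih
    -- The CJEP needs nontrivial chains. A trivial `C` receives no embedding from a nontrivial
    -- chain, so then `s` is empty and `A i` itself serves.
    rcases subsingleton_or_nontrivial C with hsub | hnon
    · refine ⟨A i, inferInstance, hA i, fun j hj => ?_⟩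
      rcases Finset.mem_insert.1 hj with rfl | hj
      · exact ⟨_, IsEmbedding.id⟩
      · obtain ⟨f, hf⟩ := hf j hj
        exact (not_subsingleton (A j) hf.injective.subsingleton).elim
    · obtain ⟨D, _, hD, ⟨g, hg⟩, ⟨k, hk⟩⟩ := hL C (A i) hC (hA i)
      refine ⟨D, inferInstance, hD, fun j hj => ?_⟩
      rcases Finset.mem_insert.1 hj with rfl | hj
      · exact ⟨k, hk⟩
      · obtain ⟨f, hf⟩ := hf j hj
        exact ⟨_, hg.comp hf⟩

/-- Under the CJEP, arbitrary families of nontrivial chains embed into a common chain. -/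
theorem CJEP.exists_chain {L : Set Formula} (hL : CJEP.{u} L) {I : Type} (A : I → Type u)
    [∀ i, MTLAlgebra (A i)] [∀ i, Nontrivial (A i)] (hA : ∀ i, IsLChain L (A i)) :
    ∃ (C : Type u) (_ : MTLAlgebra C), IsLChain L C ∧ ∀ i, ∃ f : A i → C, IsEmbedding f := by
  classical
  choose C inst hC hf using hL.exists_chain_finset A hA
  -- The maps are made total in `s`; the constant map for `i ∉ s` is a dummy, since the ultrafilter
  -- ignores those `s`.
  have hf' : ∀ s i, ∃ f : A i → C s, i ∈ s → IsEmbedding f := by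
    intro s i
    by_cases hi : i ∈ s
    · obtain ⟨f, h⟩ := hf s i hi
      exact ⟨f, fun _ => h⟩
    · exact ⟨fun _ => ⊥, fun h => (hi h).elim⟩
  choose f hf using hf'
  -- An ultrafilter refining `atTop` on finite subsets contains `{s | i ∈ s}` for each `i`.
  refine ⟨(ultraPreMTLAlgebra (Ultrafilter.of atTop) C).Quot, inferInstance,
    isLChain_ultraproduct _ C hC, fun i => ⟨_, isEmbedding_ultraproduct _ C (f := fun s => f s i) ?_⟩⟩
  have h : ∀ᶠ s : Finset I in atTop, i ∈ s :=
    (eventually_ge_atTop {i}).mono fun s hs => Finset.singleton_subset_iff.1 hs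
  exact (h.filter_mono (Ultrafilter.of_le _)).mono fun s hs => hf s i hs

theorem nontrivial_of_ne_one {A : Type u} [MTLAlgebra A] {x : A} (h : x ≠ 1) : Nontrivial A :=
  ⟨x, 1, h⟩

/-- The family to be jointly embedded is indexed by all non-derivable pairs `(Γ, φ)`, each with a
chosen refuting chain; embeddings preserve the refutations. -/
theorem CJEP.sscc {L : Set Formula} (hL : CJEP.{u} L) : SSCC.{u} L := by
  choose A inst v hA hΓ hφ using fun p : {p : Set Formula × Formula // ¬ Provable L p.1 p.2} =>
    exists_chain_of_not_provable.{u} p.2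
  have (p : _) : Nontrivial (A p) := nontrivial_of_ne_one (hφ p)
  obtain ⟨C, _, hC, hf⟩ := hL.exists_chain A hA
  refine ⟨C, inferInstance, hC, fun Γ φ => ⟨fun h => h.entails hC.1, fun h => ?_⟩⟩
  by_contra hn
  obtain ⟨f, hf⟩ := hf ⟨(Γ, φ), hn⟩
  refine hφ ⟨(Γ, φ), hn⟩ ((hf.eval_eq_one_iff _ _).1 (h _ fun γ hγ => ?_))
  exact (hf.eval_eq_one_iff _ _).2 (hΓ ⟨(Γ, φ), hn⟩ γ hγ)

theorem vars_subset_varsOf {Γ : Set Formula} {φ : Formula} (h : φ ∈ Γ) : φ.vars ⊆ varsOf Γ :=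
  Set.subset_biUnion_of_mem (u := Formula.vars) h

theorem CJEP.dmvp {L : Set Formula} (hL : CJEP.{u} L) : DMVP L := by
  classical
  intro Γ Δ φ ψ hdisj h
  by_contra! hn
  obtain ⟨A, _, v, hA, hv, hvφ⟩ := exists_chain_of_not_provable.{u} hn.1
  obtain ⟨B, _, w, hB, hw, hwψ⟩ := exists_chain_of_not_provable.{u} hn.2
  have := nontrivial_of_ne_one hvφ
  have := nontrivial_of_ne_one hwψ
  obtain ⟨C, _, hC, ⟨f, hf⟩, ⟨g, hg⟩⟩ := hL A B hA hB
  -- By disjointness, the variables of `Δ ∪ {ψ}` all fall under the second branch.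
  let z : ℕ → C := fun n => if n ∈ varsOf (Γ ∪ {φ}) then f (v n) else g (w n)
  have hzf : ∀ χ ∈ Γ ∪ {φ}, eval z χ = 1 ↔ eval v χ = 1 := fun χ hχ => by
    rw [← hf.eval_eq_one_iff, eval_congr (w := fun n => f (v n))]
    exact fun n hn => if_pos (vars_subset_varsOf hχ hn)
  have hzg : ∀ χ ∈ Δ ∪ {ψ}, eval z χ = 1 ↔ eval w χ = 1 := fun χ hχ => by
    rw [← hg.eval_eq_one_iff, eval_congr (w := fun n => g (w n))]
    exact fun n hn => if_neg (hdisj.notMem_of_mem_right (vars_subset_varsOf hχ hn))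
  have hz := h.entails hC.1 z (by
    rintro γ (hγ | hγ)
    · exact (hzf γ (Or.inl hγ)).2 (hv γ hγ)
    · exact (hzg γ (Or.inl hγ)).2 (hw γ hγ))
  rcases eval_disj_eq_one hC.2 hz with h | h
  · exact hvφ ((hzf φ (Or.inr rfl)).1 h)
  · exact hwψ ((hzg ψ (Or.inr rfl)).1 h)

theorem DMVP.hc {L : Set Formula} (hL : DMVP L) : HC L := by
  intro φ ψ hdisj h
  refine hL ∅ ∅ φ ψ ?_ (by rwa [Set.empty_union])
  simpa [varsOf] using hdisj

theorem varsOf_union_bot (Γ : Set Formula) : varsOf (Γ ∪ {bot}) = varsOf Γ := by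
  simp [varsOf, Formula.vars]

/-- Weaken `ψ` to `⊥ ∨ ψ`; the added disjunct has no variables, so disjointness survives. -/
theorem DMVP.sdprp {L : Set Formula} (hL : DMVP L) : SDPRP L := by
  intro Γ Δ ψ hdisj h
  exact hL Γ Δ bot ψ (by rwa [varsOf_union_bot]) (.mp h (.imp_disj_right _ _))

theorem SDPRP.dprp {L : Set Formula} (hL : SDPRP L) : DPRP L := by
  intro Γ ψ hdisj h
  refine hL Γ ∅ ψ ?_ (by rwa [Set.union_empty])
  simpa [varsOf] using hdisj

end MTL

theorem mainTheorem7 (L : Set MTL.Formula) :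
    (MTL.CJEP.{u} L → MTL.SSCC.{u} L ∧ MTL.HC L ∧ MTL.DMVP L ∧ MTL.SDPRP L) ∧
      (MTL.DMVP L → MTL.DPRP L) :=
  ⟨fun h => ⟨h.sscc, h.dmvp.hc, h.dmvp, h.dmvp.sdprp⟩, fun h => h.sdprp.dprp⟩
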